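/- For a non-constant polynomial $f \in \mathbb{C}[z]$ let $$\mu_f := \frac{1}{\deg f} \sum_{z \in \mathbb{C} : f(z) = 0} \mathcal{N}_f(z)\, \delta_z,$$ where $\mathcal{N}_f(z)$ is the multiplicity of the root $z$ of $f$ and $\delta_z$ is the unit point mass at $z$; if $\deg f \geq 2$, let $\mu_f' := \mu_{f'}$ denote the empirical measure of the critical points of $f$. Let $\theta_1, \theta_2, \ldots$ be a sequence of independent and identically distributed random variables, each distributed uniformly on $[0, 2\pi)$. For each $n \geq 1$, set $$p_{2n}(z) := \prod_{j=1}^{n} (z - e^{i\theta_j})(z - e^{-i\theta_j}).$$ Then $\mu_{p_{2n}}'$ converges weakly in probability as $n \to \infty$ to the uniform probability distribution $\mu$ on the unit circle centered at the origin. That is, for every bounded continuous function $f : \mathbb{C} \to \mathbb{R}$ and every $\varepsilon > 0$, $$\lim_{n \to \infty} \mathbb{P}\left( \left| \int f \, d\mu_{p_{2n}}' - \int f \, d\mu \right| > \varepsilon \right) = 0.$$ -/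

import Mathlib

open MeasureTheory ProbabilityTheory Filter Topology Polynomial
open scoped ENNReal BoundedContinuousFunction

/-- The empirical measure of the roots of `f`, counted with multiplicity:
`(1 / deg f) ∑ (multiplicity of z) δ_z`, the sum running over the distinct roots of `f`. -/
noncomputable def rootMeasure (f : ℂ[X]) : Measure ℂ :=
  (f.natDegree : ℝ≥0∞)⁻¹ •
    ∑ z ∈ f.roots.toFinset, (f.rootMultiplicity z : ℝ≥0∞) • Measure.dirac z

/-- The empirical measure of the critical points of `f`: the root measure of its derivative. -/
noncomputable def criticalMeasure (f : ℂ[X]) : Measure ℂ :=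
  rootMeasure (derivative f)

/-- The uniform probability distribution on the unit circle centered at the origin: the law of
`exp (i t)` for `t` uniform on `[0, 2π)`. -/
noncomputable def uniformCircle : Measure ℂ :=
  Measure.map (fun t : ℝ => Complex.exp (t * Complex.I))
    (ProbabilityTheory.cond volume (Set.Ico (0 : ℝ) (2 * Real.pi)))

/-- Weak convergence in probability of a sequence `ν` of random measures to a
deterministic measure `μ`. -/
def TendstoWeaklyInProbability {Ω T : Type*} [MeasurableSpace Ω] [TopologicalSpace T]
    [MeasurableSpace T] (P : Measure Ω) (ν : ℕ → Ω → Measure T) (μ : Measure T) : Prop :=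
  ∀ f : T →ᵇ ℝ, ∀ ε : ℝ, 0 < ε →
    Tendsto (fun n => P {ω | ε < |∫ x, f x ∂(ν n ω) - ∫ x, f x ∂μ|}) atTop (𝓝 0)

/-! On the circle a continuous `f` is uniformly close to `Re Q` with `Q` a polynomial, and the
uniform law integrates `Re Q` to `Re Q(0)`. It remains to see that critical points are mostly near
the circle and that their nonconstant power sums are `o(n)`.

Location: Gauss–Lucas puts the critical points `w` in the closed disk. By Vieta their product has
modulus `|p'(0)| / 2n`, and `1 - x ≤ -log x` gives `∑ (1 - |w|) ≤ log (2n / |p'(0)|)`. Here `p(0) =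
1` and `p'(0) = -S` with `S = ∑ 2 cos θ_j`. Conditioning on all angles but one shows `|S| ≤ 1/n`
with probability at most `n^(-1/2)`; otherwise the logarithm is at most `log (2n²) = o(n)`
(`sum_one_sub_norm_criticalPoints_le`, `measure_abs_sum_two_cos_le`).

Power sums: a Newton-type recurrence bounds the difference between the `k`-th power sums of roots
and of critical points by a constant depending only on `k` (`exists_norm_powerSum_sub_le`). Those of
the roots are `∑ 2 cos (k θ_j)`, which is `o(n)` almost surely by the strong law.
`abs_integral_criticalMeasure_sub_le` joins the two estimates. -/

/-! ### Power sums of critical points -/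

/-- The generating series `∑_{k ≥ 1} (∑_z z ^ k) X ^ k` of the power sums of a multiset. -/
noncomputable def powerSumSeries (Z : Multiset ℂ) : PowerSeries ℂ :=
  PowerSeries.mk fun k => if k = 0 then 0 else (Z.map (· ^ k)).sum

theorem powerSumSeries_cons (z : ℂ) (Z : Multiset ℂ) :
    powerSumSeries (z ::ₘ Z) = powerSumSeries {z} + powerSumSeries Z := by
  ext k
  by_cases hk : k = 0 <;> simp [powerSumSeries, hk]

theorem one_sub_mul_powerSumSeries_singleton (z : ℂ) :
    (1 - PowerSeries.C z * PowerSeries.X) * powerSumSeries {z} =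
      PowerSeries.C z * PowerSeries.X := by
  ext k
  rw [sub_mul, one_mul, mul_assoc]
  rcases k with _ | _ | k
  · simp [powerSumSeries]
  · simp [powerSumSeries, PowerSeries.coeff_succ_X_mul]
  · simp [powerSumSeries, PowerSeries.coeff_succ_X_mul, pow_succ]
    ring

/-- Logarithmic differentiation: each factor contributes the geometric series `zX / (1 - zX)`. This
is the generating-function form of Newton's identities. -/
theorem X_mul_derivative_prod_one_sub (Z : Multiset ℂ) :
    PowerSeries.X * PowerSeries.derivative ℂ
        (Z.map fun z => 1 - PowerSeries.C z * PowerSeries.X).prod =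
      -((Z.map fun z => 1 - PowerSeries.C z * PowerSeries.X).prod * powerSumSeries Z) := by
  induction Z using Multiset.induction_on with
  | empty =>
    have : powerSumSeries 0 = 0 := by ext k; simp [powerSumSeries]
    simp [this]
  | cons z Z ih =>
    simp only [Multiset.map_cons, Multiset.prod_cons, powerSumSeries_cons]
    set A := (Z.map fun z => 1 - PowerSeries.C z * PowerSeries.X).prod
    have h1 := one_sub_mul_powerSumSeries_singleton z
    have h2 : PowerSeries.derivative ℂ (1 - PowerSeries.C z * PowerSeries.X) =
        -PowerSeries.C z := by
      simp [Derivation.leibniz]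
    rw [Derivation.leibniz, h2]
    simp only [smul_eq_mul]
    linear_combination (1 - PowerSeries.C z * PowerSeries.X) * ih + A * h1

theorem reverse_prod_X_sub_C (Z : Multiset ℂ) :
    ((Z.map fun z => X - C z).prod).reverse = (Z.map fun z => 1 - C z * X).prod := by
  induction Z using Multiset.induction_on with
  | empty => simpa using reverse_C (1 : ℂ)
  | cons z Z ih =>
    rw [Multiset.map_cons, Multiset.prod_cons, reverse_mul_of_domain, ih, Multiset.map_cons,
      Multiset.prod_cons]
    congr 1
    rw [reverse, natDegree_X_sub_C, reflect_sub, reflect_one_X, reflect_C, pow_one]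

theorem coe_prod_one_sub (Z : Multiset ℂ) :
    (((Z.map fun z => 1 - C z * X).prod : ℂ[X]) : PowerSeries ℂ) =
      (Z.map fun z => 1 - PowerSeries.C z * PowerSeries.X).prod := by
  induction Z using Multiset.induction_on with
  | empty => simp
  | cons z Z ih => simp [ih]

theorem reverse_derivative_eq {p : ℂ[X]} (hp : 0 < p.natDegree) :
    (derivative p).reverse = C (p.natDegree : ℂ) * p.reverse - X * derivative p.reverse := by
  have hd : (derivative p).natDegree = p.natDegree - 1 := natDegree_derivative p
  ext k
  rw [coeff_sub, coeff_C_mul, coeff_reverse, coeff_derivative, hd]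
  have hX : (X * derivative p.reverse).coeff k = p.reverse.coeff k * k := by
    rcases k with _ | k
    · simp
    · rw [coeff_X_mul, coeff_derivative]; push_cast; ring
  rw [hX, coeff_reverse]
  -- For `k < N` both sides are `(N - k)` times the coefficient of degree `N - k`. At `k = N` the
  -- right side cancels, and `revAt` fixes indices beyond the degree.
  rcases lt_trichotomy k p.natDegree with h | h | h
  · rw [revAt_le (by omega), revAt_le h.le, show p.natDegree - 1 - k + 1 = p.natDegree - k by omega]
    have : ((p.natDegree - 1 - k : ℕ) : ℂ) + 1 = p.natDegree - k := by
      rw [← Nat.cast_sub h.le, show p.natDegree - k = p.natDegree - 1 - k + 1 by omega]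
      push_cast; ring
    rw [this]; ring
  · subst h
    rw [revAt_eq_self_of_lt (by omega), coeff_eq_zero_of_natDegree_lt (by omega)]
    ring
  · rw [revAt_eq_self_of_lt (by omega), revAt_eq_self_of_lt h,
      coeff_eq_zero_of_natDegree_lt (by omega), coeff_eq_zero_of_natDegree_lt h]
    ring

theorem leadingCoeff_derivative_of_monic {p : ℂ[X]} (hp : p.Monic) (hd : 0 < p.natDegree) :
    (derivative p).leadingCoeff = p.natDegree := by
  rw [leadingCoeff, natDegree_derivative, coeff_derivative,
    show p.natDegree - 1 + 1 = p.natDegree by omega, coeff_natDegree, hp.leadingCoeff, one_mul,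
    Nat.cast_sub (by omega)]
  simp

/-- With `A`, `B` the reversed root products of `p`, `p'` and `H`, `K` their power sum series,
reversing `p'` gives `N B = A (N + H)`. Applying `X d/dX`, using `X A' = -A H` and `X B' = -B K`,
and cancelling `A` yields the identity. -/
theorem powerSumSeries_derivative {p : ℂ[X]} (hp : p.Monic) (hd : 0 < p.natDegree) :
    ((p.natDegree : PowerSeries ℂ) + powerSumSeries p.roots) *
        (powerSumSeries p.roots - powerSumSeries (derivative p).roots) =
      PowerSeries.X * PowerSeries.derivative ℂ (powerSumSeries p.roots) := by
  set N := p.natDegree with hN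
  set A := (p.roots.map fun z => 1 - PowerSeries.C z * PowerSeries.X).prod with hA
  set B := ((derivative p).roots.map fun z => 1 - PowerSeries.C z * PowerSeries.X).prod with hB
  have hlead := leadingCoeff_derivative_of_monic hp hd
  have hsp := (IsAlgClosed.splits p).eq_prod_roots
  have hsd := (IsAlgClosed.splits (derivative p)).eq_prod_roots
  rw [hp.leadingCoeff, C_1, one_mul] at hsp
  rw [hlead] at hsd
  have hAr : (p.reverse : PowerSeries ℂ) = A := by
    conv_lhs => rw [hsp]
    rw [reverse_prod_X_sub_C, coe_prod_one_sub]
  have hBr : ((derivative p).reverse : PowerSeries ℂ) = N * B := by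
    conv_lhs => rw [hsd]
    rw [reverse_mul_of_domain, reverse_C, reverse_prod_X_sub_C, Polynomial.coe_mul,
      coe_prod_one_sub, Polynomial.coe_C, map_natCast]
  have hA0 : A ≠ 0 := by
    rw [← hAr]
    simpa using hp.ne_zero
  have key := congrArg (fun q : ℂ[X] => (q : PowerSeries ℂ)) (reverse_derivative_eq hd)
  simp only [Polynomial.coe_sub, Polynomial.coe_mul, Polynomial.coe_X, Polynomial.coe_C,
    hAr, hBr, ← PowerSeries.derivative_coe, ← hN] at key
  rw [map_natCast] at key
  have hXA := X_mul_derivative_prod_one_sub p.roots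
  have hXB := X_mul_derivative_prod_one_sub (derivative p).roots
  rw [← hA] at hXA
  rw [← hB] at hXB
  have hAH : (N : PowerSeries ℂ) * B = A * (N + powerSumSeries p.roots) := by
    rw [key, hXA]; ring
  have hder := congrArg (fun q => PowerSeries.X * PowerSeries.derivative ℂ q) hAH
  simp only [Derivation.leibniz, smul_eq_mul, map_add, Derivation.map_natCast] at hder
  apply mul_left_cancel₀ hA0
  linear_combination hder - (N : PowerSeries ℂ) * hXB
    + (N + powerSumSeries p.roots) * hXA + powerSumSeries (derivative p).roots * hAH

theorem powerSum_recurrence {p : ℂ[X]} (hp : p.Monic) (hd : 0 < p.natDegree) (k : ℕ) :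
    (p.natDegree : ℂ) * (PowerSeries.coeff k (powerSumSeries p.roots) -
        PowerSeries.coeff k (powerSumSeries (derivative p).roots)) =
      k * PowerSeries.coeff k (powerSumSeries p.roots) -
        ∑ i ∈ Finset.range k, PowerSeries.coeff (k - i) (powerSumSeries p.roots) *
          (PowerSeries.coeff i (powerSumSeries p.roots) -
            PowerSeries.coeff i (powerSumSeries (derivative p).roots)) := by
  have h := congrArg (PowerSeries.coeff k) (powerSumSeries_derivative hp hd)
  have hX : PowerSeries.coeff k (PowerSeries.X *
      PowerSeries.derivative ℂ (powerSumSeries p.roots)) =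
      PowerSeries.coeff k (powerSumSeries p.roots) * k := by
    rcases k with _ | k
    · simp
    · rw [PowerSeries.coeff_succ_X_mul, PowerSeries.coeff_derivative]; push_cast; ring
  rw [hX, add_mul, map_add, ← map_natCast PowerSeries.C, PowerSeries.coeff_C_mul,
    mul_comm (powerSumSeries p.roots), PowerSeries.coeff_mul,
    Finset.Nat.sum_antidiagonal_eq_sum_range_succ_mk, Finset.sum_range_succ, Nat.sub_self] at h
  -- The zero constant coefficient removes the term `i = k`, so the recurrence involves only earlier
  -- differences.
  have h0 : PowerSeries.coeff 0 (powerSumSeries p.roots) = 0 := by simp [powerSumSeries]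
  rw [h0, mul_zero, add_zero, map_sub] at h
  simp only [map_sub] at h
  rw [Finset.sum_congr rfl fun i _ => mul_comm _ _]
  linear_combination h

theorem norm_coeff_powerSumSeries_le {Z : Multiset ℂ} (hZ : ∀ z ∈ Z, ‖z‖ ≤ 1) (k : ℕ) :
    ‖PowerSeries.coeff k (powerSumSeries Z)‖ ≤ Z.card := by
  rw [powerSumSeries, PowerSeries.coeff_mk]
  split_ifs
  · simp
  · refine (norm_multiset_sum_le _).trans ?_
    rw [Multiset.map_map]
    refine (Multiset.sum_le_card_nsmul _ 1 ?_).trans (by simp)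
    intro x hx
    obtain ⟨z, hz, rfl⟩ := Multiset.mem_map.1 hx
    simpa using pow_le_one₀ (norm_nonneg _) (hZ z hz)

/-- The `k`-th power sums of the roots and of the critical points of a monic polynomial with all
roots in the closed unit disk differ by at most a constant depending only on `k`. -/
theorem exists_norm_powerSum_sub_le (k : ℕ) :
    ∃ c : ℝ, ∀ p : ℂ[X], p.Monic → 0 < p.natDegree → (∀ z ∈ p.roots, ‖z‖ ≤ 1) →
      ‖PowerSeries.coeff k (powerSumSeries p.roots) -
        PowerSeries.coeff k (powerSumSeries (derivative p).roots)‖ ≤ c := by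
  induction k using Nat.strong_induction_on with
  | _ k ih =>
    choose! c hc using ih
    -- Every power sum of the roots is at most `N` in norm, so dividing the recurrence by `N` leaves
    -- a bound free of `N`.
    refine ⟨k + ∑ i ∈ Finset.range k, c i, fun p hp hd hZ => ?_⟩
    have hN : (0 : ℝ) < p.natDegree := by exact_mod_cast hd
    have hs : ∀ i, ‖PowerSeries.coeff i (powerSumSeries p.roots)‖ ≤ p.natDegree := fun i => by
      refine (norm_coeff_powerSumSeries_le hZ i).trans ?_
      exact_mod_cast card_roots' p
    have h := congrArg norm (powerSum_recurrence hp hd k)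
    rw [norm_mul, Complex.norm_natCast] at h
    refine le_of_mul_le_mul_left ?_ hN
    rw [h, mul_add, Finset.mul_sum]
    refine (norm_sub_le _ _).trans (add_le_add ?_ ?_)
    · rw [norm_mul, Complex.norm_natCast, mul_comm]
      gcongr
      exact hs k
    · refine (norm_sum_le _ _).trans (Finset.sum_le_sum fun i hi => ?_)
      rw [norm_mul]
      gcongr
      · exact hs _
      · exact hc i (Finset.mem_range.1 hi) p hp hd hZ

/-! ### Harmonic approximation -/

/-- On the unit circle negative powers are conjugates of positive ones. -/
theorem exists_polynomial_of_mem_span_fourier {T : ℝ} {h : C(AddCircle T, ℂ)}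
    (hh : h ∈ Submodule.span ℂ (Set.range (@fourier T))) :
    ∃ Q R : ℂ[X], ∀ x, h x = Q.eval (x.toCircle : ℂ) +
      (starRingEnd ℂ) (R.eval (x.toCircle : ℂ)) := by
  induction hh using Submodule.span_induction with
  | mem h hh =>
    obtain ⟨n, rfl⟩ := hh
    obtain ⟨n, rfl | rfl⟩ := n.eq_nat_or_neg
    · refine ⟨X ^ n, 0, fun x => ?_⟩
      simp [fourier_apply, AddCircle.toCircle_nsmul]
    · refine ⟨0, X ^ n, fun x => ?_⟩
      rw [fourier_neg, fourier_apply]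
      simp [AddCircle.toCircle_nsmul]
  | zero => exact ⟨0, 0, by simp⟩
  | add f g _ _ hf hg =>
    obtain ⟨Q, R, h1⟩ := hf
    obtain ⟨Q', R', h2⟩ := hg
    refine ⟨Q + Q', R + R', fun x => ?_⟩
    simp only [ContinuousMap.add_apply, h1, h2, eval_add, map_add]
    ring
  | smul c f _ hf =>
    obtain ⟨Q, R, h1⟩ := hf
    refine ⟨C c * Q, C ((starRingEnd ℂ) c) * R, fun x => ?_⟩
    simp only [ContinuousMap.smul_apply, h1, eval_mul, eval_C, map_mul, Complex.conj_conj,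
      smul_eq_mul]
    ring

theorem exists_polynomial_re_near_on_circle {f : ℂ → ℝ} (hf : Continuous f) {ε : ℝ}
    (hε : 0 < ε) : ∃ Q : ℂ[X], ∀ z : ℂ, ‖z‖ = 1 → |f z - (Q.eval z).re| ≤ ε := by
  have : Fact (0 < 2 * Real.pi) := ⟨Real.two_pi_pos⟩
  let g : C(AddCircle (2 * Real.pi), ℂ) :=
    ⟨fun x => (f (x.toCircle : ℂ) : ℂ), by
      have := AddCircle.continuous_toCircle (T := 2 * Real.pi)
      fun_prop⟩
  have hg : g ∈ (Submodule.span ℂ (Set.range (@fourier (2 * Real.pi)))).topologicalClosure := by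
    rw [span_fourier_closure_eq_top]; trivial
  rw [← SetLike.mem_coe, Submodule.topologicalClosure_coe, Metric.mem_closure_iff] at hg
  obtain ⟨h, hh, hd⟩ := hg ε hε
  obtain ⟨Q, R, hQR⟩ := exists_polynomial_of_mem_span_fourier hh
  -- Conjugating `R` does not change its real part.
  refine ⟨Q + R, fun z hz => ?_⟩
  have hx : ∃ x : AddCircle (2 * Real.pi), (x.toCircle : ℂ) = z := by
    refine ⟨(Complex.arg z : AddCircle (2 * Real.pi)), ?_⟩
    rw [AddCircle.toCircle_apply_mk, div_self Real.two_pi_pos.ne', one_mul, Circle.coe_exp]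
    simpa [hz] using Complex.norm_mul_exp_arg_mul_I z
  obtain ⟨x, rfl⟩ := hx
  have h1 := (ContinuousMap.dist_apply_le_dist (f := g) (g := h) x).trans hd.le
  rw [dist_eq_norm] at h1
  refine le_trans ?_ ((Complex.abs_re_le_norm _).trans h1)
  rw [Complex.sub_re, hQR x]
  simp [g]

/-- The part of the disk where `|g| ≥ ε'` is compact and misses the circle, so `1 - ‖z‖` has a
positive lower bound `m` there. If `M` bounds `|g|` on the disk, `c = M / m` suffices. -/
theorem exists_abs_le_add_mul_one_sub_norm {g : ℂ → ℝ} (hg : Continuous g) {ε ε' : ℝ}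
    (h0 : 0 ≤ ε) (hεε' : ε < ε') (hcirc : ∀ z : ℂ, ‖z‖ = 1 → |g z| ≤ ε) :
    ∃ c : ℝ, 0 ≤ c ∧ ∀ z : ℂ, ‖z‖ ≤ 1 → |g z| ≤ ε' + c * (1 - ‖z‖) := by
  have hball : IsCompact {z : ℂ | ‖z‖ ≤ 1} := by
    simpa [Metric.closedBall, dist_eq_norm] using isCompact_closedBall (0 : ℂ) 1
  have hK : IsCompact ({z : ℂ | ‖z‖ ≤ 1} ∩ {z | ε' ≤ |g z|}) :=
    hball.inter_right (isClosed_le continuous_const hg.abs)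
  obtain ⟨m, hm, hmK⟩ := hK.exists_forall_le' (f := fun z : ℂ => 1 - ‖z‖) (a := 0)
    (by fun_prop) (fun z hz => by
      rcases lt_or_eq_of_le (show ‖z‖ ≤ 1 from hz.1) with h | h
      · simpa using h
      · exact absurd (hz.2.trans (hcirc z h)) (not_le.2 hεε'))
  obtain ⟨M, hM⟩ := hball.exists_bound_of_continuousOn hg.continuousOn
  have hM0 : 0 ≤ M := (norm_nonneg _).trans (hM 0 (by simp))
  refine ⟨M / m, by positivity, fun z hz => ?_⟩
  by_cases h : ε' ≤ |g z|
  · have h1 : M ≤ M / m * (1 - ‖z‖) := by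
      rw [div_mul_eq_mul_div, le_div_iff₀ hm]
      exact mul_le_mul_of_nonneg_left (hmK z ⟨hz, h⟩) hM0
    have h2 := hM z hz
    rw [Real.norm_eq_abs] at h2
    linarith
  · have : 0 ≤ M / m * (1 - ‖z‖) := mul_nonneg (by positivity) (by linarith)
    linarith

/-! ### Integrals against root measures -/

theorem integral_rootMeasure (q : ℂ[X]) (f : ℂ → ℝ) :
    ∫ z, f z ∂(rootMeasure q) = (q.natDegree : ℝ)⁻¹ * (q.roots.map f).sum := by
  rw [rootMeasure, integral_smul_measure, integral_finsetSum_measure, Finset.sum_multiset_map_count]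
  · simp [integral_smul_measure, count_roots]
  · intro z _
    exact (integrable_dirac (by simp)).smul_measure (by simp)

theorem sum_map_eval_eq (Q : ℂ[X]) (W : Multiset ℂ) :
    (W.map fun w => Q.eval w).sum = W.card * Q.coeff 0 +
      ∑ k ∈ Finset.range (Q.natDegree + 1), Q.coeff k * PowerSeries.coeff k (powerSumSeries W) := by
  induction W using Multiset.induction_on with
  | empty => simp [powerSumSeries]
  | cons w W ih =>
    rw [powerSumSeries_cons]
    simp only [Multiset.map_cons, Multiset.sum_cons, Multiset.card_cons, map_add, mul_add,
      Finset.sum_add_distrib, ih]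
    have : Q.eval w = Q.coeff 0 + ∑ k ∈ Finset.range (Q.natDegree + 1),
        Q.coeff k * PowerSeries.coeff k (powerSumSeries {w}) := by
      rw [eval_eq_sum_range, Finset.sum_range_succ', Finset.sum_range_succ']
      simp [powerSumSeries]
      ring
    rw [this]
    push_cast
    ring

/-! ### Critical points near the unit circle -/

theorem norm_le_one_of_mem_roots_derivative {p : ℂ[X]} (hp : 0 < p.degree)
    (hZ : ∀ z ∈ p.roots, ‖z‖ ≤ 1) {w : ℂ} (hw : w ∈ (derivative p).roots) : ‖w‖ ≤ 1 := by
  have h1 : w ∈ (derivative p).rootSet ℂ := by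
    rw [mem_rootSet, coe_aeval_eq_eval]
    exact ⟨ne_zero_of_mem_roots hw, isRoot_of_mem_roots hw⟩
  have h2 := rootSet_derivative_subset_convexHull_rootSet hp h1
  have h3 : p.rootSet ℂ ⊆ Metric.closedBall (0 : ℂ) 1 := by
    intro z hz
    rw [mem_rootSet, coe_aeval_eq_eval] at hz
    simpa using hZ z ((mem_roots hz.1).2 hz.2)
  simpa using convexHull_min h3 (convex_closedBall _ _) h2

theorem sum_one_sub_norm_le_neg_log_norm_prod (W : Multiset ℂ) (h0 : ∀ w ∈ W, w ≠ 0) :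
    (W.map fun w => 1 - ‖w‖).sum ≤ -Real.log ‖W.prod‖ := by
  induction W using Multiset.induction_on with
  | empty => simp
  | cons w W ih =>
    have hw := h0 w (by simp)
    have hW := ih fun v hv => h0 v (by simp [hv])
    have hp : W.prod ≠ 0 := by
      rw [Ne, Multiset.prod_eq_zero_iff]
      exact fun h => h0 0 (by simp [h]) rfl
    rw [Multiset.map_cons, Multiset.sum_cons, Multiset.prod_cons, norm_mul,
      Real.log_mul (by simpa using hw) (by simpa using hp)]
    have := Real.log_le_sub_one_of_pos (norm_pos_iff.2 hw)
    linarith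

/-- Vieta: `p'` has leading coefficient `N`, so its roots have product of modulus `|p'(0)| / N`. -/
theorem sum_one_sub_norm_criticalPoints_le {p : ℂ[X]} (hp : p.Monic) (hd : 0 < p.natDegree)
    (h0 : (derivative p).eval 0 ≠ 0) :
    ((derivative p).roots.map fun w => 1 - ‖w‖).sum ≤
      Real.log (p.natDegree / ‖(derivative p).eval 0‖) := by
  refine (sum_one_sub_norm_le_neg_log_norm_prod _ fun w hw hw0 => ?_).trans (le_of_eq ?_)
  · subst hw0
    exact h0 (isRoot_of_mem_roots hw)
  · have h := congrArg norm ((IsAlgClosed.splits (derivative p)).coeff_zero_eq_leadingCoeff_mul_prod_roots)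
    rw [norm_mul, norm_mul, norm_pow, norm_neg, norm_one, one_pow, one_mul,
      leadingCoeff_derivative_of_monic hp hd, Complex.norm_natCast, coeff_zero_eq_eval_zero] at h
    have hN : (0 : ℝ) < p.natDegree := by exact_mod_cast hd
    have h0' := norm_pos_iff.2 h0
    rw [h, ← Real.log_inv]
    congr 1
    field_simp

/-- A deterministic bound on the distance of the critical measure to the constant term of a
harmonic approximant of the test function. -/
theorem abs_integral_criticalMeasure_sub_le {p : ℂ[X]} (hp : p.Monic) (hd : 2 ≤ p.natDegree)
    (hZ : ∀ z ∈ p.roots, ‖z‖ ≤ 1) (h0 : (derivative p).eval 0 ≠ 0) {f : ℂ → ℝ} {Q : ℂ[X]}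
    {ε c : ℝ} (hc : 0 ≤ c) (hf : ∀ z : ℂ, ‖z‖ ≤ 1 → |f z - (Q.eval z).re| ≤ ε + c * (1 - ‖z‖))
    {d : ℕ → ℝ}
    (hdk : ∀ k, ‖PowerSeries.coeff k (powerSumSeries p.roots) -
      PowerSeries.coeff k (powerSumSeries (derivative p).roots)‖ ≤ d k) :
    |∫ z, f z ∂(criticalMeasure p) - (Q.coeff 0).re| ≤ ε +
      (c * Real.log (p.natDegree / ‖(derivative p).eval 0‖) +
        ∑ k ∈ Finset.range (Q.natDegree + 1), ‖Q.coeff k‖ *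
          (‖PowerSeries.coeff k (powerSumSeries p.roots)‖ + d k)) / (p.natDegree - 1) := by
  have hM : (0 : ℝ) < p.natDegree - 1 := by
    have : (2 : ℝ) ≤ p.natDegree := by exact_mod_cast hd
    linarith
  set W := (derivative p).roots with hW
  have hdeg : ((derivative p).natDegree : ℝ) = p.natDegree - 1 := by
    rw [natDegree_derivative, Nat.cast_sub (by omega)]; simp
  have hcard : (W.card : ℝ) = p.natDegree - 1 := by
    rw [← hdeg, ← (IsAlgClosed.splits (derivative p)).natDegree_eq_card_roots]
  rw [criticalMeasure, integral_rootMeasure, hdeg, ← hW]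
  have hWn : ∀ w ∈ W, ‖w‖ ≤ 1 := fun w hw =>
    norm_le_one_of_mem_roots_derivative (natDegree_pos_iff_degree_pos.1 (by omega)) hZ hw
  have e1 : |(W.map f).sum - ((W.map fun w => Q.eval w).sum).re| ≤
      W.card * ε + c * (W.map fun w => 1 - ‖w‖).sum := by
    clear_value W
    clear hW hcard hdk
    induction W using Multiset.induction_on with
    | empty => simp
    | cons w W ih =>
      have h1 := ih fun v hv => hWn v (by simp [hv])
      have h2 := hf w (hWn w (by simp))
      simp only [Multiset.map_cons, Multiset.sum_cons, Multiset.card_cons, Complex.add_re]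
      push_cast
      rw [abs_le] at *
      constructor <;> linarith [h1.1, h1.2, h2.1, h2.2]
  have e2 := sum_one_sub_norm_criticalPoints_le hp (by omega) h0
  rw [← hW] at e2
  -- Apart from its constant term, `Q` sees `W` only through power sums, which are within `d k` of
  -- those of the roots.
  have e3 : |((W.map fun w => Q.eval w).sum).re - W.card * (Q.coeff 0).re| ≤
      ∑ k ∈ Finset.range (Q.natDegree + 1), ‖Q.coeff k‖ *
          (‖PowerSeries.coeff k (powerSumSeries p.roots)‖ + d k) := by
    rw [sum_map_eval_eq, Complex.add_re, ← Complex.ofReal_natCast, Complex.re_ofReal_mul,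
      add_sub_cancel_left]
    refine (Complex.abs_re_le_norm _).trans ((norm_sum_le _ _).trans
      (Finset.sum_le_sum fun k _ => ?_))
    rw [norm_mul]
    gcongr
    have := norm_sub_norm_le (PowerSeries.coeff k (powerSumSeries W))
      (PowerSeries.coeff k (powerSumSeries p.roots))
    rw [norm_sub_rev] at this
    linarith [hdk k]
  rw [hcard] at e1 e3
  have e4 : (p.natDegree - 1 : ℝ)⁻¹ * (W.map f).sum - (Q.coeff 0).re =
      ((W.map f).sum - (p.natDegree - 1) * (Q.coeff 0).re) / (p.natDegree - 1) := by
    field_simp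
  rw [e4, abs_div, abs_of_pos hM, div_le_iff₀ hM, add_mul, div_mul_cancel₀ _ hM.ne']
  have e5 := mul_le_mul_of_nonneg_left e2 hc
  have e6 := abs_sub_le (W.map f).sum ((W.map fun w => Q.eval w).sum).re
    ((p.natDegree - 1) * (Q.coeff 0).re)
  linarith

/-! ### The polynomials with conjugate pairs of roots on the unit circle -/

/-- The polynomial with roots `exp (± i t_j)` for `j < n`. -/
noncomputable def conjPairPoly (t : ℕ → ℝ) (n : ℕ) : ℂ[X] :=
  ∏ j ∈ Finset.range n,
    (X - C (Complex.exp (Complex.I * (t j : ℂ)))) * (X - C (Complex.exp (-Complex.I * (t j : ℂ))))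

theorem conjPairPoly_succ (t : ℕ → ℝ) (n : ℕ) :
    conjPairPoly t (n + 1) = conjPairPoly t n *
      ((X - C (Complex.exp (Complex.I * (t n : ℂ)))) *
        (X - C (Complex.exp (-Complex.I * (t n : ℂ))))) :=
  Finset.prod_range_succ _ _

theorem conjPairPoly_monic (t : ℕ → ℝ) (n : ℕ) : (conjPairPoly t n).Monic :=
  monic_prod_of_monic _ _ fun _ _ => (monic_X_sub_C _).mul (monic_X_sub_C _)

theorem natDegree_conjPairPoly (t : ℕ → ℝ) (n : ℕ) : (conjPairPoly t n).natDegree = 2 * n := by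
  induction n with
  | zero => simp [conjPairPoly]
  | succ n ih =>
    rw [conjPairPoly_succ, (conjPairPoly_monic t n).natDegree_mul
      ((monic_X_sub_C _).mul (monic_X_sub_C _)), ih,
      (monic_X_sub_C _).natDegree_mul (monic_X_sub_C _), natDegree_X_sub_C, natDegree_X_sub_C]
    ring

theorem norm_eq_one_of_mem_roots_conjPairPoly {t : ℕ → ℝ} {n : ℕ} {z : ℂ}
    (hz : z ∈ (conjPairPoly t n).roots) : ‖z‖ = 1 := by
  have h := isRoot_of_mem_roots hz
  rw [conjPairPoly, IsRoot, eval_prod, Finset.prod_eq_zero_iff] at h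
  obtain ⟨j, -, hj⟩ := h
  simp only [eval_mul, eval_sub, eval_X, eval_C, mul_eq_zero, sub_eq_zero] at hj
  rcases hj with rfl | rfl <;> simp [Complex.norm_exp]

theorem exp_mul_exp_neg_I (t : ℝ) :
    Complex.exp (Complex.I * t) * Complex.exp (-Complex.I * t) = 1 := by
  rw [← Complex.exp_add]; simp

theorem exp_add_exp_neg_I (t : ℝ) :
    Complex.exp (Complex.I * t) + Complex.exp (-Complex.I * t) = (2 * Real.cos t : ℝ) := by
  push_cast
  rw [Complex.two_cos, mul_comm, ← mul_comm (t : ℂ)]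
  ring_nf

theorem eval_zero_conjPairPoly (t : ℕ → ℝ) (n : ℕ) : (conjPairPoly t n).eval 0 = 1 := by
  rw [conjPairPoly, eval_prod]
  refine Finset.prod_eq_one fun j _ => ?_
  rw [← exp_mul_exp_neg_I (t j)]
  simp

/-- Each conjugate pair gives the factor `z² - 2 cos (t_j) z + 1`, with value `1` and derivative `-2
cos (t_j)` at `0`. -/
theorem eval_zero_derivative_conjPairPoly (t : ℕ → ℝ) (n : ℕ) :
    (derivative (conjPairPoly t n)).eval 0 = -((∑ j ∈ Finset.range n, 2 * Real.cos (t j) : ℝ) : ℂ) := by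
  induction n with
  | zero => simp [conjPairPoly]
  | succ n ih =>
    have h1 := exp_mul_exp_neg_I (t n)
    have h2 := exp_add_exp_neg_I (t n)
    rw [conjPairPoly_succ, derivative_mul, eval_add, eval_mul, eval_mul, eval_mul (p := conjPairPoly t n), ih,
      eval_zero_conjPairPoly, Finset.sum_range_succ, Complex.ofReal_add, ← h2]
    simp only [eval_mul, eval_sub, eval_X, eval_C, derivative_mul, derivative_sub, derivative_X,
      derivative_C, eval_add, eval_one, eval_zero]
    linear_combination (-((∑ j ∈ Finset.range n, 2 * Real.cos (t j) : ℝ) : ℂ)) * h1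

theorem coeff_powerSumSeries_conjPairPoly (t : ℕ → ℝ) (n k : ℕ) (hk : k ≠ 0) :
    PowerSeries.coeff k (powerSumSeries (conjPairPoly t n).roots) =
      ((∑ j ∈ Finset.range n, 2 * Real.cos (k * t j) : ℝ) : ℂ) := by
  induction n with
  | zero => simp [conjPairPoly, powerSumSeries]
  | succ n ih =>
    have h2 := exp_add_exp_neg_I (k * t n)
    rw [conjPairPoly_succ, roots_mul, roots_mul, roots_X_sub_C, roots_X_sub_C,
      add_comm (conjPairPoly t n).roots, Multiset.singleton_add, Multiset.cons_add,
      Multiset.singleton_add, powerSumSeries_cons, powerSumSeries_cons, map_add, map_add, ih,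
      Finset.sum_range_succ, Complex.ofReal_add, ← h2]
    · simp only [powerSumSeries, PowerSeries.coeff_mk, if_neg hk, Multiset.map_singleton,
        Multiset.sum_singleton, ← Complex.exp_nat_mul]
      push_cast
      ring_nf
    · exact ((monic_X_sub_C _).mul (monic_X_sub_C _)).ne_zero
    · rw [← conjPairPoly_succ]; exact (conjPairPoly_monic t _).ne_zero

/-! ### Anti-concentration of the sum of cosines -/

/-- For `s ≤ t`, `cos s - cos t = 2 sin ((s+t)/2) sin ((t-s)/2)` is at least `2 sin² ((t-s)/2)`, and
Jordan's inequality bounds the sine below by `(t-s)/π`. The square root reflects the quadratic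
extrema of cosine at `0` and `π`. -/
theorem abs_sub_le_of_abs_cos_sub_le {s t δ : ℝ} (hs : s ∈ Set.Icc 0 Real.pi)
    (ht : t ∈ Set.Icc 0 Real.pi) (h : |Real.cos s - Real.cos t| ≤ δ) :
    |s - t| ≤ Real.pi * √δ := by
  wlog hst : s ≤ t generalizing s t
  · rw [abs_sub_comm] at h ⊢
    exact this ht hs h (not_le.1 hst).le
  obtain ⟨hs0, hs1⟩ := hs
  obtain ⟨ht0, ht1⟩ := ht
  have hπ := Real.pi_pos
  have h1 : 2 / Real.pi * ((t - s) / 2) ≤ Real.sin ((t - s) / 2) :=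
    Real.mul_le_sin (by linarith) (by linarith)
  have h2 : Real.sin ((t - s) / 2) ≤ Real.sin ((s + t) / 2) := by
    rw [← sub_nonneg, Real.sin_sub_sin]
    have a := Real.sin_nonneg_of_nonneg_of_le_pi (x := s / 2) (by linarith) (by linarith)
    have b := Real.cos_nonneg_of_mem_Icc (x := t / 2) ⟨by linarith, by linarith⟩
    have e1 : ((s + t) / 2 - (t - s) / 2) / 2 = s / 2 := by ring
    have e2 : ((s + t) / 2 + (t - s) / 2) / 2 = t / 2 := by ring
    rw [e1, e2]
    positivity
  have h3 : Real.cos s - Real.cos t = 2 * Real.sin ((s + t) / 2) * Real.sin ((t - s) / 2) := by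
    rw [Real.cos_sub_cos, show (s - t) / 2 = -((t - s) / 2) by ring, Real.sin_neg]; ring
  have h4 : 0 ≤ 2 / Real.pi * ((t - s) / 2) := by
    have : 0 ≤ t - s := by linarith
    positivity
  have h5 : ((t - s) / Real.pi) ^ 2 ≤ δ := by
    have e : (t - s) / Real.pi = 2 / Real.pi * ((t - s) / 2) := by ring
    rw [e]
    nlinarith [le_abs_self (Real.cos s - Real.cos t)]
  have h6 := Real.le_sqrt_of_sq_le h5
  rw [abs_sub_comm, abs_of_nonneg (by linarith)]
  rwa [div_le_iff₀' hπ] at h6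

theorem volume_two_cos_add_le (a δ : ℝ) :
    volume {t | t ∈ Set.Ico (0 : ℝ) (2 * Real.pi) ∧ |2 * Real.cos t + a| ≤ δ} ≤
      ENNReal.ofReal (2 * Real.pi * √δ) := by
  have hpair : ∀ x y : ℝ, |2 * x + a| ≤ δ → |2 * y + a| ≤ δ → |x - y| ≤ δ := fun x y hx hy => by
    rw [abs_le] at *
    constructor <;> linarith [hx.1, hx.2, hy.1, hy.2]
  set A := {t | t ∈ Set.Ico (0 : ℝ) (2 * Real.pi) ∧ |2 * Real.cos t + a| ≤ δ} with hA
  have h1 : volume (A ∩ Set.Iic Real.pi) ≤ ENNReal.ofReal (Real.pi * √δ) := by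
    refine (Real.volume_le_diam _).trans (Metric.ediam_le_of_forall_dist_le ?_)
    rintro s ⟨⟨hs, hs'⟩, hs1⟩ t ⟨⟨ht, ht'⟩, ht1⟩
    exact abs_sub_le_of_abs_cos_sub_le ⟨hs.1, hs1⟩ ⟨ht.1, ht1⟩ (hpair _ _ hs' ht')
  have h2 : volume (A ∩ Set.Ioi Real.pi) ≤ ENNReal.ofReal (Real.pi * √δ) := by
    refine (Real.volume_le_diam _).trans (Metric.ediam_le_of_forall_dist_le ?_)
    rintro s ⟨⟨hs, hs'⟩, hs1⟩ t ⟨⟨ht, ht'⟩, ht1⟩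
    rw [Set.mem_Ioi] at hs1 ht1
    -- The reflection `t ↦ 2π - t` preserves cosine and maps this half into `[0, π]`.
    have := abs_sub_le_of_abs_cos_sub_le (s := 2 * Real.pi - s) (t := 2 * Real.pi - t) (δ := δ)
      ⟨by linarith [hs.2], by linarith⟩ ⟨by linarith [ht.2], by linarith⟩
      (by rw [Real.cos_two_pi_sub, Real.cos_two_pi_sub]; exact hpair _ _ hs' ht')
    rwa [show 2 * Real.pi - s - (2 * Real.pi - t) = -(s - t) by ring, abs_neg] at this
  calc volume A ≤ volume (A ∩ Set.Iic Real.pi ∪ A ∩ Set.Ioi Real.pi) := by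
        rw [← Set.inter_union_distrib_left, Set.Iic_union_Ioi, Set.inter_univ]
    _ ≤ _ := measure_union_le _ _
    _ ≤ _ := add_le_add h1 h2
    _ = _ := by
      rw [← ENNReal.ofReal_add (by positivity) (by positivity)]
      congr 1; ring

section
variable {Ω : Type*} [MeasurableSpace Ω] {P : Measure Ω}

theorem measure_abs_two_cos_add_le {X : Ω → ℝ} (hX : Measurable X)
    (hunif : pdf.IsUniform X (Set.Ico (0 : ℝ) (2 * Real.pi)) P volume) (a δ : ℝ) :
    P {ω | |2 * Real.cos (X ω) + a| ≤ δ} ≤ ENNReal.ofReal √δ := by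
  have hm : MeasurableSet {t : ℝ | |2 * Real.cos t + a| ≤ δ} :=
    measurableSet_le (by fun_prop) measurable_const
  have h1 : P {ω | |2 * Real.cos (X ω) + a| ≤ δ} =
      P.map X {t : ℝ | |2 * Real.cos t + a| ≤ δ} := (Measure.map_apply hX hm).symm
  rw [h1, hunif, cond_apply measurableSet_Ico, Real.volume_Ico, sub_zero]
  refine (mul_le_mul_right (volume_two_cos_add_le a δ) _).trans (le_of_eq ?_)
  rw [ENNReal.ofReal_mul Real.two_pi_pos.le, ← mul_assoc, ENNReal.inv_mul_cancel, one_mul]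
  · simp [Real.pi_pos]
  · exact ENNReal.ofReal_ne_top

/-- By Fubini, condition on `R`: the bound holds for each fixed shift, hence on average. -/
theorem ProbabilityTheory.IndepFun.measure_abs_add_le [IsProbabilityMeasure P] {X R : Ω → ℝ}
    (hX : Measurable X) (hR : Measurable R) (h : IndepFun R X P) {δ : ℝ} {c : ℝ≥0∞}
    (hc : ∀ a, P {ω | |X ω + a| ≤ δ} ≤ c) : P {ω | |X ω + R ω| ≤ δ} ≤ c := by
  have hm : MeasurableSet {x : ℝ × ℝ | |x.2 + x.1| ≤ δ} :=
    measurableSet_le (by fun_prop) measurable_const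
  have h1 : P {ω | |X ω + R ω| ≤ δ} =
      P.map (fun ω => (R ω, X ω)) {x : ℝ × ℝ | |x.2 + x.1| ≤ δ} :=
    (Measure.map_apply (hR.prodMk hX) hm).symm
  have := Measure.isProbabilityMeasure_map (μ := P) hR.aemeasurable
  have := Measure.isProbabilityMeasure_map (μ := P) hX.aemeasurable
  rw [h1, (indepFun_iff_map_prod_eq_prod_map_map hR.aemeasurable hX.aemeasurable).1 h,
    Measure.prod_apply hm]
  calc _ ≤ ∫⁻ _, c ∂(P.map R) := by
        refine lintegral_mono fun r => ?_
        rw [Measure.map_apply hX (measurable_prodMk_left hm)]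
        exact hc r
    _ = c := by simp

theorem measure_abs_sum_two_cos_le [IsProbabilityMeasure P] {θ : ℕ → Ω → ℝ}
    (hmeas : ∀ j, Measurable (θ j)) (hindep : iIndepFun θ P)
    (hunif : ∀ j, pdf.IsUniform (θ j) (Set.Ico (0 : ℝ) (2 * Real.pi)) P volume) {n : ℕ}
    (hn : n ≠ 0) (δ : ℝ) :
    P {ω | |∑ j ∈ Finset.range n, 2 * Real.cos (θ j ω)| ≤ δ} ≤ ENNReal.ofReal √δ := by
  obtain ⟨m, rfl⟩ := Nat.exists_eq_succ_of_ne_zero hn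
  have hg : Measurable fun t : ℝ => 2 * Real.cos t := by fun_prop
  have hgm : ∀ j, Measurable fun ω => 2 * Real.cos (θ j ω) := fun j => hg.comp (hmeas j)
  have hind : iIndepFun (fun j ω => 2 * Real.cos (θ j ω)) P :=
    hindep.comp (fun _ t => 2 * Real.cos t) fun _ => hg
  have h := hind.indepFun_finsetSum_of_notMem hgm (s := Finset.range m) (i := m) (by simp)
  rw [show (∑ j ∈ Finset.range m, fun ω => 2 * Real.cos (θ j ω)) =
    fun ω => ∑ j ∈ Finset.range m, 2 * Real.cos (θ j ω) by ext; simp] at h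
  have := h.measure_abs_add_le (hgm m) (Finset.measurable_sum _ fun j _ => hgm j)
    (measure_abs_two_cos_add_le (hmeas m) (hunif m) · δ)
  convert this using 4 with ω
  rw [Finset.sum_range_succ, add_comm]

/-! ### Moments of the uniform law -/

theorem integral_exp_pow_cond_Ico {k : ℕ} (hk : k ≠ 0) :
    ∫ t, Complex.exp (t * Complex.I) ^ k ∂(cond volume (Set.Ico (0 : ℝ) (2 * Real.pi))) = 0 := by
  rw [ProbabilityTheory.cond, integral_smul_measure, integral_Ico_eq_integral_Ioc,
    ← intervalIntegral.integral_of_le Real.two_pi_pos.le]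
  have hc : (k : ℂ) * Complex.I ≠ 0 := by simp [hk]
  have : ∀ t : ℝ, Complex.exp (t * Complex.I) ^ k = Complex.exp (k * Complex.I * t) := fun t => by
    rw [← Complex.exp_nat_mul]; ring_nf
  simp_rw [this]
  rw [integral_exp_mul_complex hc]
  have : Complex.exp (k * Complex.I * (2 * Real.pi : ℝ)) = 1 := by
    rw [Complex.exp_eq_one_iff]
    exact ⟨k, by push_cast; ring⟩
  rw [this]
  simp

instance isProbabilityMeasure_cond_Ico_two_pi :
    IsProbabilityMeasure (cond volume (Set.Ico (0 : ℝ) (2 * Real.pi))) :=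
  cond_isProbabilityMeasure_of_finite (by simp [Real.pi_pos])
    (by rw [Real.volume_Ico]; exact ENNReal.ofReal_ne_top)

theorem integrable_exp_pow_cond_Ico (k : ℕ) :
    Integrable (fun t : ℝ => Complex.exp (t * Complex.I) ^ k)
      (cond volume (Set.Ico (0 : ℝ) (2 * Real.pi))) := by
  refine Integrable.of_bound (C := 1) (by fun_prop) (ae_of_all _ fun t => ?_)
  simp [Complex.norm_exp]

theorem integral_cos_cond_Ico {k : ℕ} (hk : k ≠ 0) :
    ∫ t, 2 * Real.cos (k * t) ∂(cond volume (Set.Ico (0 : ℝ) (2 * Real.pi))) = 0 := by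
  have h := congrArg Complex.re (integral_exp_pow_cond_Ico hk)
  have h' := integral_re (𝕜 := ℂ) (integrable_exp_pow_cond_Ico k)
  simp only [RCLike.re_eq_complex_re] at h'
  rw [← h', Complex.zero_re] at h
  rw [integral_const_mul]
  refine mul_eq_zero_of_right _ ((integral_congr_ae (ae_of_all _ fun t => ?_)).trans h)
  rw [← Complex.exp_nat_mul, ← mul_assoc]
  have : (k : ℂ) * t = ((k * t : ℝ) : ℂ) := by push_cast; rfl
  rw [this, Complex.exp_ofReal_mul_I_re]

/-- The mean value property: nonconstant monomials integrate to zero over the circle. -/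
theorem integral_eval_exp_cond_Ico (Q : ℂ[X]) :
    ∫ t, Q.eval (Complex.exp (t * Complex.I)) ∂(cond volume (Set.Ico (0 : ℝ) (2 * Real.pi))) =
      Q.coeff 0 := by
  simp_rw [eval_eq_sum_range]
  rw [integral_finsetSum _ fun k _ => (integrable_exp_pow_cond_Ico k).const_mul _,
    Finset.sum_range_succ', Finset.sum_eq_zero]
  · simp
  · intro k _
    rw [integral_const_mul, integral_exp_pow_cond_Ico (Nat.succ_ne_zero k), mul_zero]

theorem abs_integral_uniformCircle_sub_le (f : ℂ →ᵇ ℝ) {Q : ℂ[X]} {ε : ℝ}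
    (hQ : ∀ z : ℂ, ‖z‖ = 1 → |f z - (Q.eval z).re| ≤ ε) :
    |∫ z, f z ∂uniformCircle - (Q.coeff 0).re| ≤ ε := by
  have hQi : Integrable (fun t : ℝ => Q.eval (Complex.exp (t * Complex.I)))
      (cond volume (Set.Ico (0 : ℝ) (2 * Real.pi))) := by
    simp_rw [eval_eq_sum_range]
    exact integrable_finsetSum _ fun k _ => (integrable_exp_pow_cond_Ico k).const_mul _
  have hfi : Integrable (fun t : ℝ => f (Complex.exp (t * Complex.I)))
      (cond volume (Set.Ico (0 : ℝ) (2 * Real.pi))) := by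
    refine Integrable.of_bound (C := ‖f‖) ?_ (ae_of_all _ fun t => f.norm_coe_le_norm _)
    exact (f.continuous.comp (by fun_prop)).aestronglyMeasurable
  have h1 := integral_re (𝕜 := ℂ) hQi
  simp only [RCLike.re_eq_complex_re] at h1
  have hQr : Integrable (fun t : ℝ => (Q.eval (Complex.exp (t * Complex.I))).re)
      (cond volume (Set.Ico (0 : ℝ) (2 * Real.pi))) := hQi.re
  rw [uniformCircle, integral_map (by fun_prop) f.continuous.aestronglyMeasurable,
    ← integral_eval_exp_cond_Ico Q, ← h1, ← integral_sub hfi hQr, ← Real.norm_eq_abs]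
  refine (norm_integral_le_of_norm_le_const (ae_of_all _ fun t => ?_)).trans
    (by rw [probReal_univ, mul_one])
  exact hQ _ (by simp [Complex.norm_exp])

end

/-! ### Convergence -/

section
variable {Ω : Type*} [MeasurableSpace Ω] {P : Measure Ω}

theorem ae_tendsto_sum_two_cos_div [IsProbabilityMeasure P] {θ : ℕ → Ω → ℝ}
    (hmeas : ∀ j, Measurable (θ j)) (hindep : iIndepFun θ P)
    (hunif : ∀ j, pdf.IsUniform (θ j) (Set.Ico (0 : ℝ) (2 * Real.pi)) P volume) {k : ℕ}
    (hk : k ≠ 0) :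
    ∀ᵐ ω ∂P, Tendsto (fun n : ℕ => (∑ j ∈ Finset.range n, 2 * Real.cos (k * θ j ω)) / n)
      atTop (𝓝 0) := by
  have hg : Measurable fun t : ℝ => 2 * Real.cos (k * t) := by fun_prop
  have hlaw : ∀ j, IdentDistrib (θ j) (θ 0) P P := fun j =>
    ⟨(hmeas j).aemeasurable, (hmeas 0).aemeasurable, (hunif j).trans (hunif 0).symm⟩
  have h := strong_law_ae_real (μ := P) (fun j ω => 2 * Real.cos (k * θ j ω))
    (Integrable.of_bound (C := 2) (hg.comp (hmeas 0)).aestronglyMeasurable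
      (ae_of_all _ fun ω => by
        rw [norm_mul, Real.norm_eq_abs, Real.norm_eq_abs, abs_two]
        linarith [Real.abs_cos_le_one (k * θ 0 ω)]))
    (fun i j hij => (hindep.indepFun hij).comp hg hg)
    (fun j => (hlaw j).comp hg)
  have h0 : ∫ ω, 2 * Real.cos (k * θ 0 ω) ∂P = 0 := by
    rw [← integral_map (f := fun t => 2 * Real.cos (k * t)) (hmeas 0).aemeasurable
      hg.aestronglyMeasurable, hunif 0]
    exact integral_cos_cond_Ico hk
  rwa [h0] at h

theorem tendsto_div_two_mul_sub_one {u : ℕ → ℝ} (hu : Tendsto (fun n : ℕ => u n / n) atTop (𝓝 0)) :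
    Tendsto (fun n : ℕ => u n / (2 * n - 1)) atTop (𝓝 0) := by
  refine squeeze_zero_norm' ?_ (by simpa only [norm_zero] using hu.norm)
  filter_upwards [eventually_ge_atTop 1] with n hn
  have hn' : (1 : ℝ) ≤ n := by exact_mod_cast hn
  rw [norm_div, norm_div, Real.norm_of_nonneg (by linarith : (0 : ℝ) ≤ 2 * n - 1),
    Real.norm_of_nonneg (by linarith : (0 : ℝ) ≤ n)]
  gcongr
  linarith

theorem tendsto_log_two_mul_sq_div :
    Tendsto (fun n : ℕ => Real.log (2 * n * n) / (2 * n - 1)) atTop (𝓝 0) := by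
  apply tendsto_div_two_mul_sub_one
  have h1 : Tendsto (fun n : ℕ => Real.log n / n) atTop (𝓝 0) :=
    (Real.isLittleO_log_id_atTop.tendsto_div_nhds_zero).comp tendsto_natCast_atTop_atTop
  have h2 : Tendsto (fun n : ℕ => Real.log 2 / n) atTop (𝓝 0) :=
    tendsto_const_div_atTop_nhds_zero_nat _
  have h3 := h2.add (h1.add h1)
  simp only [add_zero] at h3
  refine h3.congr' ?_
  filter_upwards [eventually_ne_atTop 0] with n hn
  have hn' : (n : ℝ) ≠ 0 := by exact_mod_cast hn
  rw [mul_assoc, Real.log_mul two_ne_zero (mul_ne_zero hn' hn'), Real.log_mul hn' hn']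
  ring

theorem tendsto_measure_le_weighted_powerSums [IsProbabilityMeasure P] {θ : ℕ → Ω → ℝ}
    (hmeas : ∀ j, Measurable (θ j)) (hindep : iIndepFun θ P)
    (hunif : ∀ j, pdf.IsUniform (θ j) (Set.Ico (0 : ℝ) (2 * Real.pi)) P volume)
    (s : Finset ℕ) (a d : ℕ → ℝ) {ε : ℝ} (hε : 0 < ε) :
    Tendsto (fun n : ℕ => P {ω | ε ≤ (∑ k ∈ s, a k *
      (‖PowerSeries.coeff k (powerSumSeries (conjPairPoly (θ · ω) n).roots)‖ + d k)) /
        (2 * n - 1)}) atTop (𝓝 0) := by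
  have hcoeff : ∀ k n ω,
      ‖PowerSeries.coeff k (powerSumSeries (conjPairPoly (θ · ω) n).roots)‖ =
        if k = 0 then 0 else |∑ j ∈ Finset.range n, 2 * Real.cos (k * θ j ω)| := by
    intro k n ω
    split_ifs with hk
    · simp [hk, powerSumSeries]
    · rw [coeff_powerSumSeries_conjPairPoly _ _ _ hk, Complex.norm_real, Real.norm_eq_abs]
  simp_rw [hcoeff]
  set Z : ℕ → Ω → ℝ := fun n ω => (∑ k ∈ s, a k *
    ((if k = 0 then 0 else |∑ j ∈ Finset.range n, 2 * Real.cos (k * θ j ω)|) + d k)) /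
      (2 * n - 1) with hZ
  have hZm : ∀ n, Measurable (Z n) := by
    intro n
    refine (Finset.measurable_sum _ fun k _ => ?_).div_const _
    refine ((Measurable.ite (by simp) measurable_const ?_).add_const _).const_mul _
    fun_prop
  have hlim : ∀ᵐ ω ∂P, Tendsto (fun n => Z n ω) atTop (𝓝 0) := by
    have hall : ∀ᵐ ω ∂P, ∀ k : ℕ, k ≠ 0 →
        Tendsto (fun n : ℕ => (∑ j ∈ Finset.range n, 2 * Real.cos (k * θ j ω)) / n)
          atTop (𝓝 0) := by
      rw [ae_all_iff]
      intro k
      by_cases hk : k = 0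
      · simp [hk]
      · filter_upwards [ae_tendsto_sum_two_cos_div hmeas hindep hunif hk] with ω h _ using h
    filter_upwards [hall] with ω hω
    apply tendsto_div_two_mul_sub_one
    simp_rw [Finset.sum_div]
    suffices h : ∀ k ∈ s, Tendsto (fun n : ℕ => a k *
        ((if k = 0 then 0 else |∑ j ∈ Finset.range n, 2 * Real.cos (k * θ j ω)|) + d k) / (n : ℝ))
        atTop (𝓝 0) by
      have h' := tendsto_finsetSum s h
      rwa [Finset.sum_const_zero] at h'
    intro k _
    have h1 : Tendsto (fun n : ℕ =>
        (if k = 0 then 0 else |∑ j ∈ Finset.range n, 2 * Real.cos (k * θ j ω)|) / (n : ℝ))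
        atTop (𝓝 0) := by
      split_ifs with hk
      · simp
      · simpa [abs_div] using (hω k hk).abs
    have h2 : Tendsto (fun n : ℕ => d k / (n : ℝ)) atTop (𝓝 0) :=
      tendsto_const_div_atTop_nhds_zero_nat _
    have h3 := (h1.add h2).const_mul (a k)
    rw [add_zero, mul_zero] at h3
    refine h3.congr fun n => ?_
    ring
  have hmeasure := tendstoInMeasure_of_tendsto_ae (fun n => (hZm n).aestronglyMeasurable) hlim
  -- Almost sure convergence gives convergence in measure.
  refine tendsto_of_tendsto_of_tendsto_of_le_of_le tendsto_const_nhds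
    (hmeasure (ENNReal.ofReal ε) (by simpa using hε)) (fun _ => zero_le) fun n => ?_
  refine measure_mono fun ω hω => ?_
  change ENNReal.ofReal ε ≤ edist (Z n ω) 0
  rw [edist_dist, Real.dist_eq, sub_zero]
  exact ENNReal.ofReal_le_ofReal (le_trans hω (le_abs_self _))

theorem tendsto_measure_abs_sum_two_cos_le_inv [IsProbabilityMeasure P] {θ : ℕ → Ω → ℝ}
    (hmeas : ∀ j, Measurable (θ j)) (hindep : iIndepFun θ P)
    (hunif : ∀ j, pdf.IsUniform (θ j) (Set.Ico (0 : ℝ) (2 * Real.pi)) P volume) :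
    Tendsto (fun n : ℕ => P {ω | |∑ j ∈ Finset.range n, 2 * Real.cos (θ j ω)| ≤ (n : ℝ)⁻¹})
      atTop (𝓝 0) := by
  have h : Tendsto (fun n : ℕ => ENNReal.ofReal √((n : ℝ)⁻¹)) atTop (𝓝 0) := by
    rw [← ENNReal.ofReal_zero, ← Real.sqrt_zero]
    exact ENNReal.tendsto_ofReal (tendsto_inv_atTop_nhds_zero_nat.sqrt)
  refine tendsto_of_tendsto_of_tendsto_of_le_of_le' tendsto_const_nhds h
    (.of_forall fun _ => zero_le) ?_
  filter_upwards [eventually_ne_atTop 0] with n hn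
  exact measure_abs_sum_two_cos_le hmeas hindep hunif hn _

end

theorem corollary2p6 {Ω : Type*} [MeasurableSpace Ω] (P : Measure Ω) [IsProbabilityMeasure P]
    (θ : ℕ → Ω → ℝ) (hmeas : ∀ j, Measurable (θ j)) (hindep : iIndepFun θ P)
    (hunif : ∀ j, pdf.IsUniform (θ j) (Set.Ico (0 : ℝ) (2 * Real.pi)) P volume) :
    TendstoWeaklyInProbability P
      (fun n ω => criticalMeasure
        (∏ j ∈ Finset.range n,
          (X - C (Complex.exp (Complex.I * (θ j ω : ℂ)))) *
            (X - C (Complex.exp (-Complex.I * (θ j ω : ℂ))))))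
      uniformCircle := by
  intro f ε hε
  change Tendsto (fun n => P {ω | ε < |∫ x, f x ∂(criticalMeasure (conjPairPoly (θ · ω) n)) -
    ∫ x, f x ∂uniformCircle|}) atTop (𝓝 0)
  -- Error budget: `ε/8` for the uniform law and `ε/4` each for the approximation on the disk, the
  -- logarithm and the power sums, in all `7ε/8`.
  obtain ⟨Q, hQ⟩ := exists_polynomial_re_near_on_circle f.continuous (show 0 < ε / 8 by positivity)
  obtain ⟨c, hc, hfQ⟩ := exists_abs_le_add_mul_one_sub_norm
    (g := fun z => f z - (Q.eval z).re) (ε' := ε / 4)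
    (f.continuous.sub (Complex.continuous_re.comp Q.continuous)) (by positivity)
    (by linarith) hQ
  choose d hd using exists_norm_powerSum_sub_le
  have hunifCircle := abs_integral_uniformCircle_sub_le f hQ
  have hlog := (tendsto_log_two_mul_sq_div.const_mul c).eventually_lt_const
    (show c * 0 < ε / 4 by rw [mul_zero]; positivity)
  have hlim := (tendsto_measure_abs_sum_two_cos_le_inv hmeas hindep hunif).add
    (tendsto_measure_le_weighted_powerSums hmeas hindep hunif (Finset.range (Q.natDegree + 1))
      (fun k => ‖Q.coeff k‖) d (show 0 < ε / 4 by positivity))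
  rw [add_zero] at hlim
  refine tendsto_of_tendsto_of_tendsto_of_le_of_le' tendsto_const_nhds hlim
    (.of_forall fun _ => zero_le) ?_
  filter_upwards [hlog, eventually_ge_atTop 1] with n hn hn1
  refine (measure_mono fun ω hω => ?_).trans (measure_union_le _ _)
  -- Outside the two exceptional events, `|S| > 1/n` and the power sum term is below `ε/4`, so the
  -- deterministic bound applies.
  by_contra hcon
  simp only [Set.mem_union, Set.mem_ofPred_eq, not_or, not_le] at hcon
  obtain ⟨hS, hZ⟩ := hcon
  refine absurd (show ε < _ from hω) (not_lt.2 ?_)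
  have hnpos : (0 : ℝ) < n := by exact_mod_cast hn1
  have hn1' : (1 : ℝ) ≤ n := by exact_mod_cast hn1
  set S := ∑ j ∈ Finset.range n, 2 * Real.cos (θ j ω) with hSdef
  have hS0 : 0 < |S| := (inv_pos.2 hnpos).trans hS
  have heval : ‖(derivative (conjPairPoly (θ · ω) n)).eval 0‖ = |S| := by
    rw [eval_zero_derivative_conjPairPoly, norm_neg, Complex.norm_real, Real.norm_eq_abs]
  have hdeg : ((conjPairPoly (θ · ω) n).natDegree : ℝ) = 2 * n := by
    rw [natDegree_conjPairPoly]; push_cast; rfl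
  have hroots : ∀ z ∈ (conjPairPoly (θ · ω) n).roots, ‖z‖ ≤ 1 := fun z hz =>
    (norm_eq_one_of_mem_roots_conjPairPoly hz).le
  have hmain := abs_integral_criticalMeasure_sub_le (conjPairPoly_monic (θ · ω) n)
    (by rw [natDegree_conjPairPoly]; omega) hroots
    (norm_pos_iff.1 (heval ▸ hS0)) hc hfQ (d := d)
    (fun k => hd k _ (conjPairPoly_monic _ n) (by rw [natDegree_conjPairPoly]; omega) hroots)
  rw [heval, hdeg, add_div] at hmain
  have hlogle : c * Real.log (2 * n / |S|) / (2 * n - 1) ≤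
      c * (Real.log (2 * n * n) / (2 * n - 1)) := by
    rw [← mul_div_assoc]
    have : (0 : ℝ) < 2 * n - 1 := by linarith
    have h2 : 2 * (n : ℝ) / |S| ≤ 2 * n * n := by
      rw [div_eq_mul_inv]
      have := inv_lt_of_inv_lt₀ hnpos hS
      gcongr
    gcongr
  rw [abs_sub_comm] at hunifCircle
  have htri := abs_sub_le (∫ z, f z ∂(criticalMeasure (conjPairPoly (θ · ω) n)))
    (Q.coeff 0).re (∫ z, f z ∂uniformCircle)
  linarith
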